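/- \textbf{Setting.} Consider a grid with finitely many buses, generators $\mathcal G$, branches $\mathcal B$ and lines $\mathcal E\subseteq\mathcal B$, and dispatch intervals $\mathcal T=\{1,\dots,M\}$ of length $\Delta>0$. Let $x=(p^{G},\iota,q^{G},e,f,I^{\mathrm{re}},I^{\mathrm{im}})$ (generation, squared line-current magnitudes, reactive generation, real and imaginary voltages, real and imaginary line currents) and $y=(\hat p^{G},\hat\iota,\hat T)$ (local copies of generation and squared currents, and line temperatures), and let $X=\{x: x_t\in \mathrm{AC}_t\ \forall t\in\mathcal T\}$ be defined by the rectangular AC power flow constraints (real and reactive power balance, voltage, angle and generation limits, and current equations). Let $C(x)=\sum_{t}\sum_{g}C_g(p^G_{g,t})$ with each $C_g$ differentiable. Let $Y$ be the set of $y$ such that every generator satisfies its ramping constraints $P_g^{-}\le \hat p^G_{g,t}-\hat p^G_{g,t-1}\le P_g^{+}$ ($t\ge2$), giving a set $\mathrm{Rmp}_g$, and every line $l\in\mathcal E$ satisfies $\mathrm{Tmp}_l$: $\hat\iota_{l,t}\ge0$, $\hat T_{l,t}=\Phi_l^t(\hat\iota_{l})\le T^{\max}$ for all $t$. Here $\Phi_l^t$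 maps the squared currents to the temperature at the end of interval $t$, in the transient model or in the steady-state model. In the transient model, start from a given initial temperature $T_{l,0}>0$ and on each interval $t$ solve for time $\Delta$ the heat equation $T'=-K_{4,l}T^4-K_{1,l,t}T+K_{0,l,t}'+r_l'\hat\iota_{l,t}$, where all of $K_4,K_1,K_0',r'$ are positive. In the steady-state model, $\Phi_l^t$ is the positive root of the right-hand side of this equation for interval $t$. Let $A=(-I\ \ 0)$ and $B=(I\ \ 0)$ be the selection matrices for which $Ax+By=0$ means $\hat p^G=p^G$, $\hat\iota=\iota$. Fix a vector $w$, $\theta>0$ and $\rho=2\theta$. With $p=Ax+By+u$, put $$\mathcal L(x,y,u,v)=C(x)+w^\top u+\tfrac\theta2\|u\|^2+v^\top p+\tfrac\rho2\|p\|^2 .$$ Let $N_S(z)$ be the general (limiting) normal cone of a set $S$ at $z\in S$. A triple $(x,y,u)$ with $x\in X$, $y\in Y$ is an \emph{$\varepsilon$-stationary point} of $$\min\ C(x)+w^\top u+\tfrac\theta2\|u\|^2\quad\text{s.t.}\quad x\in X,\ y\in Y,\ Ax+By+u=0 \tag{P}$$ if for some $v$: $\operatorname{dist}(0,\nabla C(x)+A^\top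 v+N_X(x))\le\varepsilon$, $\operatorname{dist}(0,B^\top v+N_Y(y))\le\varepsilon$ (both distances attained), $w+\theta u+v=0$ and $\|Ax+By+u\|\le\varepsilon$. \textbf{Algorithm (3-block inner ADMM).} From $(x^{(0)},y^{(0)},u^{(0)},v^{(0)})$, iteration $r\ge1$ computes successively (i) $x^{(r)}\in X$, a stationary point of $\mathcal L(\cdot,y^{(r-1)},u^{(r-1)},v^{(r-1)})$ over $X$, i.e. minus the $x$-gradient at $x^{(r)}$ lies in $N_X(x^{(r)})$; (ii) $y^{(r)}\in Y$, a stationary point of $\mathcal L(x^{(r)},\cdot,u^{(r-1)},v^{(r-1)})$ over $Y$: for each generator $g$, minus the gradient with respect to $\hat p^G_{g}$ lies in the normal cone of $\mathrm{Rmp}_g$ at $\hat p_g^{G,(r)}$; for each line, with the temperatures eliminated, the currents satisfy the KKT conditions of the line subproblem with constraints $\Phi^t_l\le T^{\max}$, with multipliers $\lambda_t\ge0$ ($t\in\mathcal T$), and $\hat\iota_{l,t}\ge0$; (iii) $u^{(r)}\in\arg\min_u\mathcal L(x^{(r)},y^{(r)},u,v^{(r-1)})$; (iv) $v^{(r)}=v^{(r-1)}+\rho\,(Ax^{(r)}+By^{(r)}+u^{(r)})$.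 \textbf{Proposition (inner convergence rate).} Let $C_\Delta$ be a number such that every $\Phi_l^t$ is $C_\Delta$-smooth (differentiable with $C_\Delta$-Lipschitz gradient) on the set of nonnegative current vectors, and let $\Lambda$ be such that $\rho\ge 2C_\Delta\Lambda$. Assume that, at every iteration, the multipliers in (ii) can be chosen with $\sum_{t\in\mathcal T}\lambda_t<\Lambda$ for each line, and that $$\mathcal L(x^{(r)},y^{(r-1)},u^{(r-1)},v^{(r-1)})\le\mathcal L(x^{(r-1)},y^{(r-1)},u^{(r-1)},v^{(r-1)}).$$ Then the algorithm attains an $\varepsilon$-stationary point of (P) in $O(1/\varepsilon^2)$ iterations: there is a constant $K$, depending only on the problem data, the temperature model, $w,\theta,C_\Delta,\Lambda$ and the initial point $(x^{(0)},y^{(0)},u^{(0)},v^{(0)})$, such that for every $\varepsilon\in(0,1]$ and every run of at least $K/\varepsilon^2$ iterations satisfying these assumptions, some iterate $(x^{(r)},y^{(r)},u^{(r)})$ with $1\le r\le K/\varepsilon^2$ is an $\varepsilon$-stationary point of (P). -/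

import Mathlib

/-! ### Normal cones and smooth functions -/

/-- The regular (Fréchet) normal cone of `S` at `x`: vectors `n` with
`⟪n, z - x⟫ ≤ o(‖z - x‖)` as `z → x` in `S`; empty when `x ∉ S`. -/
def regularNormalCone {E : Type*} [NormedAddCommGroup E] [InnerProductSpace ℝ E]
    (S : Set E) (x : E) : Set E :=
  {n | x ∈ S ∧ ∀ δ > 0, ∃ η > 0, ∀ z ∈ S, ‖z - x‖ < η → inner ℝ n (z - x) ≤ δ * ‖z - x‖}

/-- The general (limiting, Mordukhovich) normal cone of `S` at `x`. -/
def normalCone {E : Type*} [NormedAddCommGroup E] [InnerProductSpace ℝ E]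
    (S : Set E) (x : E) : Set E :=
  {n | x ∈ S ∧ ∃ (xs ns : ℕ → E), (∀ k, ns k ∈ regularNormalCone S (xs k)) ∧
    Filter.Tendsto xs Filter.atTop (nhds x) ∧ Filter.Tendsto ns Filter.atTop (nhds n)}

/-- `f` is `C`-smooth on `S`: differentiable on `S` with `C`-Lipschitz gradient. -/
def IsSmoothOn {E : Type*} [NormedAddCommGroup E] [InnerProductSpace ℝ E] [CompleteSpace E]
    (C : ℝ) (f : E → ℝ) (S : Set E) : Prop :=
  DifferentiableOn ℝ f S ∧
    ∀ a ∈ S, ∀ b ∈ S, ‖gradientWithin f S a - gradientWithin f S b‖ ≤ C * ‖a - b‖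

/-! ### Conductor temperature over one dispatch interval -/

/-- `T` solves `T' = -K₄ T⁴ - K₁ T + K₀` on `[0, Δ]`. -/
def IsHeatTrajectory (K4 K1 K0 Δ : ℝ) (T : ℝ → ℝ) : Prop :=
  ∀ τ ∈ Set.Icc 0 Δ,
    HasDerivWithinAt T (-K4 * T τ ^ 4 - K1 * T τ + K0) (Set.Icc 0 Δ) τ

theorem heatField_lipschitzOnWith (K4 K1 K0 R : ℝ) :
    ∃ K : NNReal, LipschitzOnWith K (fun x : ℝ => -K4 * x ^ 4 - K1 * x + K0)
      (Set.Icc (-R) R) := by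
  have h : ContDiff ℝ 1 (fun x : ℝ => -K4 * x ^ 4 - K1 * x + K0) := by fun_prop
  exact h.contDiffOn.exists_lipschitzOnWith one_ne_zero (convex_Icc _ _) isCompact_Icc

theorem exists_heatTrajectory {K4 K1 K0 Δ T₀ : ℝ} (hK4 : 0 < K4) (hK1 : 0 < K1)
    (hK0 : 0 < K0) (hΔ : 0 < Δ) (hT₀ : 0 ≤ T₀) :
    ∃ T : ℝ → ℝ, IsHeatTrajectory K4 K1 K0 Δ T ∧ T 0 = T₀ ∧ ∀ τ ∈ Set.Icc 0 Δ, 0 ≤ T τ := by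
  set P : ℝ → ℝ := fun x => -K4 * x ^ 4 - K1 * x + K0 with hP
  set R : ℝ := max T₀ (K0 / K1) + 1 with hR
  have hR0 : 0 < R := by have := le_max_left T₀ (K0 / K1); linarith
  have hRT : T₀ ≤ R := by have := le_max_left T₀ (K0 / K1); linarith
  have hPR : P R < 0 := by
    have h1 : K0 / K1 < R := by have := le_max_right T₀ (K0 / K1); linarith
    rw [div_lt_iff₀ hK1] at h1
    have h2 : 0 ≤ K4 * R ^ 4 := by positivity
    simp only [hP]; nlinarith
  obtain ⟨K, hK⟩ := heatField_lipschitzOnWith K4 K1 K0 R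
  set c : ℝ → ℝ := fun x => max 0 (min x R) with hc
  have hcm : ∀ x, c x ∈ Set.Icc (-R) R := fun x =>
    ⟨by have := le_max_left 0 (min x R); simp only [hc]; linarith,
      max_le hR0.le (min_le_right _ _)⟩
  have hcl : LipschitzWith 1 c := (LipschitzWith.id.min_const R).const_max 0
  have hg : LipschitzWith K (fun x => P (c x)) := by
    have := hK.comp (hcl.lipschitzOnWith (s := Set.univ)) (fun x _ => hcm x)
    rw [mul_one, lipschitzOnWith_univ] at this
    exact this
  obtain ⟨L, hL⟩ := (isCompact_Icc (a := -R) (b := R)).exists_bound_of_continuousOn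
    (f := P) (by simp only [hP]; fun_prop)
  have hpl : IsPicardLindelof (fun _ x => P (c x)) (tmin := 0) (tmax := Δ)
      ⟨0, by simp [hΔ.le]⟩ T₀ (L.toNNReal * Δ.toNNReal) 0 L.toNNReal K := by
    refine IsPicardLindelof.of_time_independent ?_ hg.lipschitzOnWith ?_
    · intro x _
      exact (hL _ (hcm x)).trans (Real.le_coe_toNNReal L)
    · simp [hΔ.le]
  obtain ⟨T, hT0, hT⟩ := hpl.exists_eq_forall_mem_Icc_hasDerivWithinAt₀
  simp only at hT0
  have hTc : ContinuousOn T (Set.Icc 0 Δ) := fun t ht => (hT t ht).continuousWithinAt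
  have hTr : ∀ t ∈ Set.Ico 0 Δ, HasDerivWithinAt T (P (c (T t))) (Set.Ici t) t := fun t ht =>
    ((hT t (Set.Ico_subset_Icc_self ht)).mono_of_mem_nhdsWithin
      (Icc_mem_nhdsGE_of_mem ht))
  have hlow : ∀ t ∈ Set.Icc 0 Δ, 0 ≤ T t := by
    intro t ht
    have := image_le_of_deriv_right_lt_deriv_boundary' (f := fun t => - T t)
      (f' := fun t => - P (c (T t))) (B := fun _ => 0) (B' := fun _ => 0) hTc.neg
      (fun t ht => (hTr t ht).neg) (by simp [hT0, hT₀]) continuousOn_const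
      (fun _ _ => hasDerivWithinAt_const _ _ _)
      (by
        intro s _ hs
        have hs' : T s = 0 := by linarith
        simp [hs', hc, hP, hR0.le, hK0]) ht
    linarith
  have hup : ∀ t ∈ Set.Icc 0 Δ, T t ≤ R := by
    intro t ht
    exact image_le_of_deriv_right_lt_deriv_boundary' (B := fun _ => R) (B' := fun _ => 0) hTc
      hTr (by simp [hT0, hRT]) continuousOn_const
      (fun _ _ => hasDerivWithinAt_const _ _ _)
      (by
        intro s _ hs
        simpa [hs, hc, hR0.le] using hPR) ht
  refine ⟨T, fun t ht => ?_, hT0, hlow⟩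
  have : c (T t) = T t := by
    simp only [hc]; rw [min_eq_left (hup t ht), max_eq_right (hlow t ht)]
  simpa [this, hP] using hT t ht

theorem heatTrajectory_unique {K4 K1 K0 Δ : ℝ} {T S : ℝ → ℝ}
    (hT : IsHeatTrajectory K4 K1 K0 Δ T) (hS : IsHeatTrajectory K4 K1 K0 Δ S)
    (h0 : T 0 = S 0) : Set.EqOn T S (Set.Icc 0 Δ) := by
  have hTc : ContinuousOn T (Set.Icc 0 Δ) := fun t ht => (hT t ht).continuousWithinAt
  have hSc : ContinuousOn S (Set.Icc 0 Δ) := fun t ht => (hS t ht).continuousWithinAt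
  obtain ⟨A, hA⟩ := isCompact_Icc.exists_bound_of_continuousOn hTc
  obtain ⟨B, hB⟩ := isCompact_Icc.exists_bound_of_continuousOn hSc
  obtain ⟨K, hK⟩ := heatField_lipschitzOnWith K4 K1 K0 (max A B)
  refine ODE_solution_unique_of_mem_Icc_right (v := fun _ x => -K4 * x ^ 4 - K1 * x + K0)
    (s := fun _ => Set.Icc (-(max A B)) (max A B)) (fun _ _ => hK) hTc
    (fun t ht => (hT t (Set.Ico_subset_Icc_self ht)).mono_of_mem_nhdsWithin
      (Icc_mem_nhdsGE_of_mem ht))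
    (fun t ht => abs_le.mp ((hA t (Set.Ico_subset_Icc_self ht)).trans (le_max_left _ _))) hSc
    (fun t ht => (hS t (Set.Ico_subset_Icc_self ht)).mono_of_mem_nhdsWithin
      (Icc_mem_nhdsGE_of_mem ht))
    (fun t ht => abs_le.mp ((hB t (Set.Ico_subset_Icc_self ht)).trans (le_max_right _ _))) h0

/-- The temperature at time `Δ` of the solution of `T' = -K₄ T⁴ - K₁ T + K₀` with `T(0) = T₀`. -/
noncomputable def heatFlow (K4 K1 K0 Δ T₀ : ℝ) : ℝ :=
  Classical.epsilon fun z => ∃ T : ℝ → ℝ, IsHeatTrajectory K4 K1 K0 Δ T ∧ T 0 = T₀ ∧ T Δ = z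

/-- In the physical range `heatFlow` really is the value at `Δ` of the (unique) solution. -/
theorem heatFlow_spec {K4 K1 K0 Δ T₀ : ℝ} (hK4 : 0 < K4) (hK1 : 0 < K1)
    (hK0 : 0 < K0) (hΔ : 0 < Δ) (hT₀ : 0 ≤ T₀) :
    0 ≤ heatFlow K4 K1 K0 Δ T₀ ∧
      (∃ T : ℝ → ℝ, IsHeatTrajectory K4 K1 K0 Δ T ∧ T 0 = T₀) ∧
      ∀ T : ℝ → ℝ, IsHeatTrajectory K4 K1 K0 Δ T → T 0 = T₀ → T Δ = heatFlow K4 K1 K0 Δ T₀ := by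
  obtain ⟨T, hT, hT0, hpos⟩ := exists_heatTrajectory hK4 hK1 hK0 hΔ hT₀
  have hex : ∃ z, ∃ T : ℝ → ℝ, IsHeatTrajectory K4 K1 K0 Δ T ∧ T 0 = T₀ ∧ T Δ = z :=
    ⟨T Δ, T, hT, hT0, rfl⟩
  obtain ⟨S, hS, hS0, hSΔ⟩ := Classical.epsilon_spec hex
  have hΔm : Δ ∈ Set.Icc 0 Δ := ⟨hΔ.le, le_rfl⟩
  have key : ∀ U : ℝ → ℝ, IsHeatTrajectory K4 K1 K0 Δ U → U 0 = T₀ →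
      U Δ = heatFlow K4 K1 K0 Δ T₀ := fun U hU hU0 =>
    (heatTrajectory_unique hU hS (hU0.trans hS0.symm) hΔm).trans hSΔ
  exact ⟨(key T hT hT0) ▸ hpos Δ hΔm, ⟨T, hT, hT0⟩, key⟩

/-- The steady-state temperature: the positive root of `K₄ s⁴ + K₁ s = K₀`. -/
noncomputable def steadyTemp (K4 K1 K0 : ℝ) : ℝ :=
  Classical.epsilon fun s => 0 < s ∧ K4 * s ^ 4 + K1 * s = K0

theorem existsUnique_steadyTemp {K4 K1 K0 : ℝ} (hK4 : 0 < K4) (hK1 : 0 < K1) (hK0 : 0 < K0) :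
    ∃! s, 0 < s ∧ K4 * s ^ 4 + K1 * s = K0 := by
  have hc : ContinuousOn (fun s : ℝ => K4 * s ^ 4 + K1 * s) (Set.Icc 0 (K0 / K1)) := by
    fun_prop
  have hR : 0 < K0 / K1 := div_pos hK0 hK1
  obtain ⟨s, hs, hs'⟩ := intermediate_value_Icc hR.le hc (show K0 ∈ Set.Icc _ _ from
    ⟨by simpa using hK0.le, by
      have h1 : K1 * (K0 / K1) = K0 := by field_simp
      have h2 : 0 ≤ K4 * (K0 / K1) ^ 4 := by positivity
      show K0 ≤ K4 * (K0 / K1) ^ 4 + K1 * (K0 / K1)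
      linarith⟩)
  simp only at hs'
  have hmono : StrictMonoOn (fun s : ℝ => K4 * s ^ 4 + K1 * s) (Set.Ici 0) := by
    intro a ha b _ hab
    have ha' : (0 : ℝ) ≤ a := ha
    show K4 * a ^ 4 + K1 * a < K4 * b ^ 4 + K1 * b
    gcongr
  have hspos : 0 < s := by
    rcases hs.1.lt_or_eq with h | h
    · exact h
    · rw [← h] at hs'; simp at hs'; linarith
  refine ⟨s, ⟨hspos, hs'⟩, fun y hy => ?_⟩
  exact hmono.injOn (Set.mem_Ici.2 hy.1.le) (Set.mem_Ici.2 hspos.le) (hy.2.trans hs'.symm)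

/-- The two temperature models. -/
inductive ThermalModel where
  | transient
  | steadyState

/-! ### Problem data -/

/-- Data of the multi-period AC optimal power flow problem with dynamic line ratings, over `M`
dispatch intervals. Branches are pairs of buses, and the lines are the branches whose current and
temperature are modelled. Line parameters are only meaningful on `lines`. -/
structure GridData (Bus Gen : Type) (M : ℕ) where
  branches : Finset (Bus × Bus)
  lines : Finset (Bus × Bus)
  lines_subset : lines ⊆ branches
  /-- the bus of each generator -/
  busOf : Gen → Bus
  /-- branch conductance `G_ij` and susceptance `B_ij` -/
  cond : Bus → Bus → ℝ
  susc : Bus → Bus → ℝ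
  /-- self and shunt conductances and susceptances of the buses -/
  condSelf : Bus → ℝ
  condShunt : Bus → ℝ
  suscSelf : Bus → ℝ
  suscShunt : Bus → ℝ
  Vmin : Bus → ℝ
  Vmax : Bus → ℝ
  angleMin : Bus × Bus → ℝ
  angleMax : Bus × Bus → ℝ
  Pmin : Gen → ℝ
  Pmax : Gen → ℝ
  Qmin : Gen → ℝ
  Qmax : Gen → ℝ
  /-- real and reactive demand -/
  PD : Bus → Fin M → ℝ
  QD : Bus → Fin M → ℝ
  /-- lower and upper bounds on the ramp of each generator -/
  rampDown : Gen → ℝ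
  rampUp : Gen → ℝ
  /-- generation costs -/
  cost : Gen → ℝ → ℝ
  cost_differentiable : ∀ g, Differentiable ℝ (cost g)
  /-- length of a dispatch interval -/
  Δ : ℝ
  Δ_pos : 0 < Δ
  /-- maximal temperature -/
  Tmax : ℝ
  /-- Stefan–Boltzmann constant -/
  sigma : ℝ
  /-- initial temperature, mass, specific heat, diameter, emissivity, resistivity of the lines -/
  Tinit : Bus × Bus → ℝ
  mass : Bus × Bus → ℝ
  heatCap : Bus × Bus → ℝ
  diam : Bus × Bus → ℝ
  emis : Bus × Bus → ℝ
  resist : Bus × Bus → ℝ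
  /-- ambient temperature, solar gain, and coefficients of the convective loss
  `q^c(T) = k^c T + k^{c,0}` -/
  Tamb : Bus × Bus → Fin M → ℝ
  solar : Bus × Bus → Fin M → ℝ
  kc : Bus × Bus → Fin M → ℝ
  kc0 : Bus × Bus → Fin M → ℝ
  sigma_pos : 0 < sigma
  Tinit_pos : ∀ l ∈ lines, 0 < Tinit l
  mass_pos : ∀ l ∈ lines, 0 < mass l
  heatCap_pos : ∀ l ∈ lines, 0 < heatCap l
  diam_pos : ∀ l ∈ lines, 0 < diam l
  emis_pos : ∀ l ∈ lines, 0 < emis l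
  resist_pos : ∀ l ∈ lines, 0 < resist l
  kc_pos : ∀ l ∈ lines, ∀ t, 0 < kc l t
  /-- the constant term of the heat equation is positive at zero current -/
  K0_pos : ∀ l ∈ lines, ∀ t,
    0 < Real.pi * diam l * emis l * sigma * Tamb l t ^ 4 + solar l t - kc0 l t

namespace GridData

/-- The lines, as a type. -/
abbrev Line {Bus Gen : Type} {M : ℕ} (D : GridData Bus Gen M) : Type := {l // l ∈ D.lines}

instance {Bus Gen : Type} [DecidableEq Bus] {M : ℕ} (D : GridData Bus Gen M) :
    DecidableEq D.Line := Subtype.instDecidableEq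

/-! ### Temperature blocks -/

noncomputable def K4 {Bus Gen : Type} {M : ℕ} (D : GridData Bus Gen M) (l : D.Line) : ℝ :=
  Real.pi * D.diam l * D.emis l * D.sigma / (D.mass l * D.heatCap l)

noncomputable def K1 {Bus Gen : Type} {M : ℕ} (D : GridData Bus Gen M) (l : D.Line)
    (t : Fin M) : ℝ :=
  D.kc l t / (D.mass l * D.heatCap l)

/-- The constant term of the heat equation when the squared current magnitude is `c`. -/
noncomputable def K0 {Bus Gen : Type} {M : ℕ} (D : GridData Bus Gen M) (l : D.Line)
    (t : Fin M) (c : ℝ) : ℝ :=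
  (Real.pi * D.diam l * D.emis l * D.sigma * D.Tamb l t ^ 4 + D.resist l * c
    + D.solar l t - D.kc0 l t) / (D.mass l * D.heatCap l)

/-- Temperature at the end of interval `t`, given the temperature `T₀` at its beginning and the
squared current magnitude `c` on it. -/
noncomputable def stepTemp {Bus Gen : Type} {M : ℕ} (D : GridData Bus Gen M) (l : D.Line)
    (t : Fin M) (T₀ c : ℝ) : ThermalModel → ℝ
  | .transient => heatFlow (D.K4 l) (D.K1 l t) (D.K0 l t c) D.Δ T₀
  | .steadyState => steadyTemp (D.K4 l) (D.K1 l t) (D.K0 l t c)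

/-- Temperature after `n` intervals. -/
noncomputable def tempAfter {Bus Gen : Type} {M : ℕ} (D : GridData Bus Gen M)
    (model : ThermalModel) (l : D.Line) (c : EuclideanSpace ℝ (Fin M)) : ℕ → ℝ
  | 0 => D.Tinit l
  | n + 1 => if h : n < M then D.stepTemp l ⟨n, h⟩ (D.tempAfter model l c n) (c ⟨n, h⟩) model
      else D.tempAfter model l c n

/-- The multi-step solution map `Φ^t`: temperature at the end of interval `t` as a function of the
squared current magnitudes. -/
noncomputable def Phi {Bus Gen : Type} {M : ℕ} (D : GridData Bus Gen M)
    (model : ThermalModel) (l : D.Line) (t : Fin M) (c : EuclideanSpace ℝ (Fin M)) : ℝ :=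
  D.tempAfter model l c (t + 1)

/-- Vectors of nonnegative squared current magnitudes, the domain of `Φ^t`. -/
def currents (M : ℕ) : Set (EuclideanSpace ℝ (Fin M)) := {c | ∀ t, 0 ≤ c t}

/-- `Tmp_l`: pairs (squared current magnitudes, temperatures) of line `l` that obey the temperature
model and the temperature limit. -/
def Tmp {Bus Gen : Type} {M : ℕ} (D : GridData Bus Gen M) (model : ThermalModel) (l : D.Line) :
    Set (EuclideanSpace ℝ (Fin M) × EuclideanSpace ℝ (Fin M)) :=
  {s | s.1 ∈ currents M ∧ ∀ t, s.2 t = D.Phi model l t s.1 ∧ s.2 t ≤ D.Tmax}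

/-- `Rmp_g`: ramping constraints of generator `g`. -/
def Rmp {Bus Gen : Type} {M : ℕ} (D : GridData Bus Gen M) (g : Gen) :
    Set (EuclideanSpace ℝ (Fin M)) :=
  {p | ∀ s t : Fin M, (t : ℕ) = s + 1 → D.rampDown g ≤ p t - p s ∧ p t - p s ≤ D.rampUp g}

/-! ### Variables -/

/-- Index set of `x = (p^G, ι, q^G, e, f, I^re, I^im)`. -/
abbrev XIdx {Bus Gen : Type} {M : ℕ} (D : GridData Bus Gen M) : Type :=
  (Gen ⊕ D.Line ⊕ Gen ⊕ Bus ⊕ Bus ⊕ D.Line ⊕ D.Line) × Fin M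

instance {Bus Gen : Type} [DecidableEq Bus] [DecidableEq Gen] {M : ℕ} (D : GridData Bus Gen M) :
    DecidableEq D.XIdx :=
  letI : DecidableEq (Bus ⊕ Bus ⊕ D.Line ⊕ D.Line) := inferInstance
  letI : DecidableEq (Gen ⊕ D.Line ⊕ Gen ⊕ Bus ⊕ Bus ⊕ D.Line ⊕ D.Line) :=
    @instDecidableEqSum _ _ _ (@instDecidableEqSum _ _ _ (@instDecidableEqSum _ _ _ this))
  instDecidableEqProd

/-- Index set of `y = (p^G, ι, T)`. -/
abbrev YIdx {Bus Gen : Type} {M : ℕ} (D : GridData Bus Gen M) : Type :=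
  (Gen ⊕ D.Line ⊕ D.Line) × Fin M

/-- Index set of the consensus constraints, on `p^G` and `ι`. -/
abbrev CIdx {Bus Gen : Type} {M : ℕ} (D : GridData Bus Gen M) : Type :=
  (Gen ⊕ D.Line) × Fin M

abbrev XSpace {Bus Gen : Type} {M : ℕ} (D : GridData Bus Gen M) : Type :=
  EuclideanSpace ℝ D.XIdx

abbrev YSpace {Bus Gen : Type} {M : ℕ} (D : GridData Bus Gen M) : Type :=
  EuclideanSpace ℝ D.YIdx

abbrev CSpace {Bus Gen : Type} {M : ℕ} (D : GridData Bus Gen M) : Type :=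
  EuclideanSpace ℝ D.CIdx

def xP {Bus Gen : Type} {M : ℕ} (D : GridData Bus Gen M) (x : D.XSpace)
    (g : Gen) (t : Fin M) : ℝ := x (.inl g, t)

def xCur {Bus Gen : Type} {M : ℕ} (D : GridData Bus Gen M) (x : D.XSpace)
    (l : D.Line) (t : Fin M) : ℝ := x (.inr (.inl l), t)

def xQ {Bus Gen : Type} {M : ℕ} (D : GridData Bus Gen M) (x : D.XSpace)
    (g : Gen) (t : Fin M) : ℝ := x (.inr (.inr (.inl g)), t)

def xE {Bus Gen : Type} {M : ℕ} (D : GridData Bus Gen M) (x : D.XSpace)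
    (i : Bus) (t : Fin M) : ℝ := x (.inr (.inr (.inr (.inl i))), t)

def xF {Bus Gen : Type} {M : ℕ} (D : GridData Bus Gen M) (x : D.XSpace)
    (i : Bus) (t : Fin M) : ℝ := x (.inr (.inr (.inr (.inr (.inl i)))), t)

def xIre {Bus Gen : Type} {M : ℕ} (D : GridData Bus Gen M) (x : D.XSpace)
    (l : D.Line) (t : Fin M) : ℝ := x (.inr (.inr (.inr (.inr (.inr (.inl l))))), t)

def xIim {Bus Gen : Type} {M : ℕ} (D : GridData Bus Gen M) (x : D.XSpace)
    (l : D.Line) (t : Fin M) : ℝ := x (.inr (.inr (.inr (.inr (.inr (.inr l))))), t)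

/-- Slices of a vector of `YSpace`. -/
def yP {Bus Gen : Type} {M : ℕ} (D : GridData Bus Gen M) (y : D.YSpace) (g : Gen) :
    EuclideanSpace ℝ (Fin M) := WithLp.toLp 2 fun t => y (.inl g, t)

def yCur {Bus Gen : Type} {M : ℕ} (D : GridData Bus Gen M) (y : D.YSpace) (l : D.Line) :
    EuclideanSpace ℝ (Fin M) := WithLp.toLp 2 fun t => y (.inr (.inl l), t)

def yTemp {Bus Gen : Type} {M : ℕ} (D : GridData Bus Gen M) (y : D.YSpace) (l : D.Line) :
    EuclideanSpace ℝ (Fin M) := WithLp.toLp 2 fun t => y (.inr (.inr l), t)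

/-! ### The AC block -/

/-- Squared voltage magnitude at bus `i`, time `t`. -/
def nu {Bus Gen : Type} {M : ℕ} (D : GridData Bus Gen M) (x : D.XSpace) (t : Fin M)
    (i : Bus) : ℝ := D.xE x i t ^ 2 + D.xF x i t ^ 2

def voltC {Bus Gen : Type} {M : ℕ} (D : GridData Bus Gen M) (x : D.XSpace) (t : Fin M)
    (i j : Bus) : ℝ := D.xE x i t * D.xE x j t + D.xF x i t * D.xF x j t

def voltS {Bus Gen : Type} {M : ℕ} (D : GridData Bus Gen M) (x : D.XSpace) (t : Fin M)
    (i j : Bus) : ℝ := D.xF x i t * D.xE x j t - D.xE x i t * D.xF x j t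

/-- Voltage angle `atan2 (f, e)`. -/
noncomputable def angle {Bus Gen : Type} {M : ℕ} (D : GridData Bus Gen M) (x : D.XSpace)
    (t : Fin M) (i : Bus) : ℝ := Complex.arg ⟨D.xE x i t, D.xF x i t⟩

/-- Neighbours of bus `i`. -/
def nbrs {Bus Gen : Type} [Fintype Bus] [DecidableEq Bus] {M : ℕ} (D : GridData Bus Gen M)
    (i : Bus) : Finset Bus :=
  Finset.univ.filter fun j => (i, j) ∈ D.branches ∨ (j, i) ∈ D.branches

/-- `AC_t`: the AC power flow constraints in interval `t`. -/
def AC {Bus Gen : Type} [Fintype Bus] [DecidableEq Bus] [Fintype Gen] {M : ℕ}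
    (D : GridData Bus Gen M) (t : Fin M) : Set D.XSpace :=
  {x |
    (∀ i, (∑ g with D.busOf g = i, D.xP x g t) - D.PD i t
      = (D.condSelf i + D.condShunt i) * D.nu x t i
        + ∑ j ∈ D.nbrs i, (D.voltC x t i j * D.cond i j + D.voltS x t i j * D.susc i j)) ∧
    (∀ i, (∑ g with D.busOf g = i, D.xQ x g t) - D.QD i t
      = -(D.suscSelf i + D.suscShunt i) * D.nu x t i
        + ∑ j ∈ D.nbrs i, (D.voltS x t i j * D.cond i j - D.voltC x t i j * D.susc i j)) ∧
    (∀ i, D.Vmin i ^ 2 ≤ D.nu x t i ∧ D.nu x t i ≤ D.Vmax i ^ 2) ∧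
    (∀ b ∈ D.branches, D.angleMin b ≤ D.angle x t b.1 - D.angle x t b.2 ∧
      D.angle x t b.1 - D.angle x t b.2 ≤ D.angleMax b) ∧
    (∀ g, D.Pmin g ≤ D.xP x g t ∧ D.xP x g t ≤ D.Pmax g) ∧
    (∀ g, D.Qmin g ≤ D.xQ x g t ∧ D.xQ x g t ≤ D.Qmax g) ∧
    (∀ l : D.Line, D.xIre x l t
      = D.cond l.1.1 l.1.2 * (D.xE x l.1.1 t - D.xE x l.1.2 t)
        - D.susc l.1.1 l.1.2 * (D.xF x l.1.1 t - D.xF x l.1.2 t)) ∧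
    (∀ l : D.Line, D.xIim x l t
      = D.cond l.1.1 l.1.2 * (D.xF x l.1.1 t - D.xF x l.1.2 t)
        + D.susc l.1.1 l.1.2 * (D.xE x l.1.1 t - D.xE x l.1.2 t)) ∧
    (∀ l : D.Line, D.xCur x l t = D.xIre x l t ^ 2 + D.xIim x l t ^ 2)}

/-- Feasible set of the `x`-block. -/
def XSet {Bus Gen : Type} [Fintype Bus] [DecidableEq Bus] [Fintype Gen] {M : ℕ}
    (D : GridData Bus Gen M) : Set D.XSpace := {x | ∀ t, x ∈ D.AC t}

/-- Feasible set of the `y`-block. -/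
def YSet {Bus Gen : Type} {M : ℕ} (D : GridData Bus Gen M) (model : ThermalModel) :
    Set D.YSpace :=
  {y | (∀ l, (D.yCur y l, D.yTemp y l) ∈ D.Tmp model l) ∧ ∀ g, D.yP y g ∈ D.Rmp g}

/-! ### Augmented Lagrangian -/

/-- Total generation cost. -/
def totalCost {Bus Gen : Type} [Fintype Gen] {M : ℕ} (D : GridData Bus Gen M)
    (x : D.XSpace) : ℝ := ∑ t, ∑ g, D.cost g (D.xP x g t)

/-- The selection matrix `A = (-I  0)`. -/
def A {Bus Gen : Type} [DecidableEq Bus] [DecidableEq Gen] {M : ℕ} (D : GridData Bus Gen M) :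
    Matrix D.CIdx D.XIdx ℝ :=
  fun c i => if i = (Sum.elim (fun g => .inl g) (fun l => .inr (.inl l)) c.1, c.2) then -1 else 0

/-- The selection matrix `B = (I  0)`. -/
def B {Bus Gen : Type} [DecidableEq Bus] [DecidableEq Gen] {M : ℕ} (D : GridData Bus Gen M) :
    Matrix D.CIdx D.YIdx ℝ :=
  fun c i => if i = (Sum.elim (fun g => .inl g) (fun l => .inr (.inl l)) c.1, c.2) then 1 else 0

/-- Primal residual `p = A x + B y + u`. -/
noncomputable def resid {Bus Gen : Type} [Fintype Bus] [DecidableEq Bus] [Fintype Gen]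
    [DecidableEq Gen] {M : ℕ} (D : GridData Bus Gen M)
    (x : D.XSpace) (y : D.YSpace) (u : D.CSpace) : D.CSpace :=
  Matrix.toEuclideanLin D.A x + Matrix.toEuclideanLin D.B y + u

/-- The augmented Lagrangian
`C(x) + wᵀu + (θ/2)‖u‖² + vᵀp + (ρ/2)‖p‖²`, where `p = A x + B y + u`. -/
noncomputable def augLag {Bus Gen : Type} [Fintype Bus] [DecidableEq Bus] [Fintype Gen]
    [DecidableEq Gen] {M : ℕ} (D : GridData Bus Gen M) (θ ρ : ℝ) (w : D.CSpace)
    (x : D.XSpace) (y : D.YSpace) (u v : D.CSpace) : ℝ :=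
  D.totalCost x + inner ℝ w u + θ / 2 * ‖u‖ ^ 2 + inner ℝ v (D.resid x y u)
    + ρ / 2 * ‖D.resid x y u‖ ^ 2

/-! ### Stationarity -/

/-- `x` is a stationary point of the `x`-subproblem: minimise the augmented Lagrangian over
`XSet`. -/
def IsXStationary {Bus Gen : Type} [Fintype Bus] [DecidableEq Bus] [Fintype Gen]
    [DecidableEq Gen] {M : ℕ} (D : GridData Bus Gen M) (θ ρ : ℝ) (w : D.CSpace)
    (x : D.XSpace) (y : D.YSpace) (u v : D.CSpace) : Prop :=
  -gradient (fun x' => D.augLag θ ρ w x' y u v) x ∈ normalCone D.XSet x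

/-- Karush–Kuhn–Tucker conditions at the currents `c` of the subproblem of line `l`, in which the
temperatures are eliminated, so that the constraints are `Φ^t(c) ≤ Tmax` and `c ≥ 0`. Here `G` is
the gradient of the objective and the multipliers of the temperature limits sum to less than
`bound`. -/
def IsTmpKKT {Bus Gen : Type} {M : ℕ} (D : GridData Bus Gen M) (model : ThermalModel)
    (l : D.Line) (bound : ℝ) (G : Fin M → ℝ) (c : EuclideanSpace ℝ (Fin M)) : Prop :=
  ∃ lam mu : Fin M → ℝ, (∀ t, 0 ≤ lam t) ∧ (∀ t, 0 ≤ mu t) ∧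
    (∀ t, lam t * (D.Phi model l t c - D.Tmax) = 0) ∧ (∀ t, mu t * c t = 0) ∧
    (∀ s, G s + ∑ t, lam t * gradientWithin (D.Phi model l t) (currents M) c s - mu s = 0) ∧
    ∑ t, lam t < bound

/-- `y` is a stationary point of the `y`-subproblem, which splits into one problem per line and one
per generator; `bound` bounds the sum of the multipliers of each line problem. -/
def IsYStationary {Bus Gen : Type} [Fintype Bus] [DecidableEq Bus] [Fintype Gen]
    [DecidableEq Gen] {M : ℕ} (D : GridData Bus Gen M) (model : ThermalModel) (θ ρ : ℝ)
    (w : D.CSpace) (bound : ℝ) (x : D.XSpace) (y : D.YSpace) (u v : D.CSpace) : Prop :=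
  (∀ l, D.IsTmpKKT model l bound
    (D.yCur (gradient (fun y' => D.augLag θ ρ w x y' u v) y) l) (D.yCur y l)) ∧
  ∀ g, -D.yP (gradient (fun y' => D.augLag θ ρ w x y' u v) y) g
    ∈ normalCone (D.Rmp g) (D.yP y g)

/-- `(x, y, u)` is an `ε`-stationary point of the problem: minimise
`C(x) + wᵀu + (θ/2)‖u‖²` over `x ∈ XSet`, `y ∈ YSet`, `A x + B y + u = 0`. -/
def IsEpsStationary {Bus Gen : Type} [Fintype Bus] [DecidableEq Bus] [Fintype Gen]
    [DecidableEq Gen] {M : ℕ} (D : GridData Bus Gen M) (model : ThermalModel) (θ : ℝ)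
    (w : D.CSpace) (ε : ℝ) (x : D.XSpace) (y : D.YSpace) (u : D.CSpace) : Prop :=
  x ∈ D.XSet ∧ y ∈ D.YSet model ∧ ∃ v : D.CSpace,
    (∃ n ∈ normalCone D.XSet x,
      ‖gradient D.totalCost x + Matrix.toEuclideanLin D.A.transpose v + n‖ ≤ ε) ∧
    (∃ n ∈ normalCone (D.YSet model) y, ‖Matrix.toEuclideanLin D.B.transpose v + n‖ ≤ ε) ∧
    w + θ • u + v = 0 ∧ ‖D.resid x y u‖ ≤ ε

/-! ### The inner algorithm -/

/-- One iteration of the three-block ADMM, from `(y, u, v)` to `(x', y', u', v')`, with the block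
minimisations over `x` and `y` solved up to stationarity. -/
structure IsAdmmStep {Bus Gen : Type} [Fintype Bus] [DecidableEq Bus] [Fintype Gen]
    [DecidableEq Gen] {M : ℕ} (D : GridData Bus Gen M) (model : ThermalModel) (θ ρ : ℝ)
    (w : D.CSpace) (bound : ℝ) (y : D.YSpace) (u v : D.CSpace)
    (x' : D.XSpace) (y' : D.YSpace) (u' v' : D.CSpace) : Prop where
  x_mem : x' ∈ D.XSet
  x_stationary : D.IsXStationary θ ρ w x' y u v
  y_mem : y' ∈ D.YSet model
  y_stationary : D.IsYStationary model θ ρ w bound x' y' u v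
  u_min : ∀ z, D.augLag θ ρ w x' y' u' v ≤ D.augLag θ ρ w x' y' z v
  v_update : v' = v + ρ • D.resid x' y' u'

end GridData

/-!
The augmented Lagrangian is a Lyapunov function of the iteration.

The block `y` is the delicate one, because the temperature limits `Φ^t ≤ Tmax` are not convex. At a
KKT point with multipliers `lam`, the descent lemma for the `CΔ`-smooth maps `Φ^t` shows that the
gradient of the `y`-objective pairs with any feasible displacement `z - y` to at least
`-(CΔ Λ / 2) ‖B (z - y)‖²`, where `Λ` bounds `∑ lam`; the ramping constraints are convex and cost
nothing. As `2 CΔ Λ ≤ ρ`, this is at least `-(ρ/4) ‖B (z - y)‖²` (`IsYStationary.le_inner`). This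
single inequality is used three times:

* with the previous `y` for `z`, it gives a decrease by `(ρ/4) ‖B (z - y)‖²` in the `y`-step, since
  the objective is quadratic with curvature `ρ` in `B y`;
* with a fixed feasible point for `z`, it bounds the first iterate, which matters because the
  initial `y` need not be feasible (`exists_augLag_le_of_isAdmmStep`);
* with `z` close to `y`, it says that minus the gradient is a regular normal to `YSet` at `y`.

The exact `u`-step and the multiplier update force `v = -(w + θ u)` after each iteration. Hence the
multiplier update raises the Lagrangian only by `(θ/2) ‖u' - u‖²`, while the `u`-step lowers it by
`(3θ/2) ‖u' - u‖²`, and an iteration decreases it by at least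
`(θ/2) ‖B (y - y')‖² + θ ‖u' - u‖²` (`IsAdmmStep.augLag_le`). The same relation makes the
Lagrangian at least `C(x) - ‖w‖² / (2θ)` (`le_augLag`), and generation, hence cost, is bounded on
the AC feasible set. So among the first `O(1/ε²)` iterations one has steps of size `O(ε)`, and
the residuals of the stationarity conditions are at most a constant times these step sizes
(`IsAdmmStep.isEpsStationary`).
-/

/-! ### Normal cones and the descent inequality -/

theorem regularNormalCone_subset_normalCone {E : Type*} [NormedAddCommGroup E]
    [InnerProductSpace ℝ E] (S : Set E) (x : E) : regularNormalCone S x ⊆ normalCone S x :=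
  fun n hn => ⟨hn.1, fun _ => x, fun _ => n, fun _ => hn, tendsto_const_nhds, tendsto_const_nhds⟩

theorem inner_le_zero_of_mem_regularNormalCone {E : Type*} [NormedAddCommGroup E]
    [InnerProductSpace ℝ E] {S : Set E} (hS : Convex ℝ S) {x n z : E}
    (hn : n ∈ regularNormalCone S x) (hz : z ∈ S) : inner ℝ n (z - x) ≤ 0 := by
  obtain ⟨hx, h⟩ := hn
  have key : ∀ δ > 0, inner ℝ n (z - x) ≤ δ * ‖z - x‖ := by
    intro δ hδ
    obtain ⟨η, hη, H⟩ := h δ hδ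
    -- shrink the step from `x` to `z` until the regular-normal estimate applies
    set s : ℝ := min 1 (η / (‖z - x‖ + 1)) with hs
    have hpos : 0 < ‖z - x‖ + 1 := by positivity
    have hs0 : 0 < s := lt_min one_pos (div_pos hη hpos)
    have hs1 : s ≤ 1 := min_le_left _ _
    have hs2 : s * (‖z - x‖ + 1) ≤ η := (le_div_iff₀ hpos).1 (min_le_right _ _)
    have hmem : x + s • (z - x) ∈ S := hS.add_smul_sub_mem hx hz ⟨hs0.le, hs1⟩
    have hnorm : ‖x + s • (z - x) - x‖ = s * ‖z - x‖ := by
      rw [add_sub_cancel_left, norm_smul, Real.norm_of_nonneg hs0.le]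
    have := H _ hmem (by rw [hnorm]; nlinarith)
    rw [hnorm, add_sub_cancel_left, real_inner_smul_right] at this
    have h2 : s * inner ℝ n (z - x) ≤ s * (δ * ‖z - x‖) := by linarith
    exact le_of_mul_le_mul_left h2 hs0
  by_contra! hc
  have h1 := key (inner ℝ n (z - x) / (2 * (‖z - x‖ + 1))) (by positivity)
  have hpos : 0 < ‖z - x‖ + 1 := by positivity
  rw [div_mul_eq_mul_div, le_div_iff₀ (by positivity)] at h1
  nlinarith [norm_nonneg (z - x)]

/-- On a convex set, limiting normals are normals in the sense of convex analysis. -/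
theorem inner_le_zero_of_mem_normalCone {E : Type*} [NormedAddCommGroup E]
    [InnerProductSpace ℝ E] {S : Set E} (hS : Convex ℝ S) {x n z : E}
    (hn : n ∈ normalCone S x) (hz : z ∈ S) : inner ℝ n (z - x) ≤ 0 := by
  obtain ⟨_, xs, ns, hreg, hxs, hns⟩ := hn
  exact le_of_tendsto (hns.inner (tendsto_const_nhds.sub hxs))
    (Filter.Eventually.of_forall fun k => inner_le_zero_of_mem_regularNormalCone hS (hreg k) hz)

/-- A vector whose pairing with feasible displacements is bounded quadratically is a regular
normal. -/
theorem mem_regularNormalCone_of_quadratic_bound {E : Type*} [NormedAddCommGroup E]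
    [InnerProductSpace ℝ E] {S : Set E} {x n : E} (hx : x ∈ S) {κ : ℝ} (hκ : 0 ≤ κ)
    (h : ∀ z ∈ S, inner ℝ n (z - x) ≤ κ * ‖z - x‖ ^ 2) : n ∈ regularNormalCone S x := by
  refine ⟨hx, fun δ hδ => ⟨δ / (κ + 1), by positivity, fun z hz hlt => (h z hz).trans ?_⟩⟩
  rw [lt_div_iff₀ (by positivity)] at hlt
  nlinarith [norm_nonneg (z - x), mul_nonneg (norm_nonneg (z - x)) (norm_nonneg (z - x))]

/-- The descent lemma: a `C`-smooth function lies above its linearisation minus `(C/2)‖b - a‖²`. -/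
theorem IsSmoothOn.sub_le {E : Type*} [NormedAddCommGroup E] [InnerProductSpace ℝ E]
    [CompleteSpace E] {C : ℝ} {f : E → ℝ} {S : Set E} (hf : IsSmoothOn C f S)
    (hS : Convex ℝ S) {a b : E} (ha : a ∈ S) (hb : b ∈ S) :
    inner ℝ (gradientWithin f S a) (b - a) - C / 2 * ‖b - a‖ ^ 2 ≤ f b - f a := by
  set d := b - a with hd
  -- along the segment, `f` minus its linearisation plus the quadratic has a nonnegative derivative
  have hseg : ∀ s ∈ Set.Icc (0 : ℝ) 1, a + s • d ∈ S := fun s hs =>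
    hS.add_smul_sub_mem ha hb hs
  have hder : ∀ s ∈ Set.Icc (0 : ℝ) 1, HasDerivWithinAt
      (fun s : ℝ => f (a + s • d) - s * inner ℝ (gradientWithin f S a) d + C / 2 * s ^ 2 * ‖d‖ ^ 2)
      (inner ℝ (gradientWithin f S (a + s • d)) d - inner ℝ (gradientWithin f S a) d
        + C * s * ‖d‖ ^ 2) (Set.Icc 0 1) s := by
    intro s hs
    have h1 := (hf.1 _ (hseg s hs)).hasGradientWithinAt.hasFDerivWithinAt
    have h2 : HasDerivWithinAt (fun s : ℝ => a + s • d) d (Set.Icc 0 1) s := by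
      simpa using ((hasDerivAt_id s).smul_const d).const_add a |>.hasDerivWithinAt
    have h3 := h1.comp_hasDerivWithinAt s h2 (fun s hs => hseg s hs)
    have h4 : HasDerivWithinAt (fun s : ℝ => s * inner ℝ (gradientWithin f S a) d)
        (inner ℝ (gradientWithin f S a) d) (Set.Icc 0 1) s := by
      simpa using ((hasDerivAt_id s).mul_const _).hasDerivWithinAt
    have h5 : HasDerivWithinAt (fun s : ℝ => C / 2 * s ^ 2 * ‖d‖ ^ 2) (C * s * ‖d‖ ^ 2)
        (Set.Icc 0 1) s := by
      have := (((hasDerivAt_pow 2 s).const_mul (C / 2)).mul_const (‖d‖ ^ 2)).hasDerivWithinAt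
        (s := Set.Icc 0 1)
      exact this.congr_deriv (by push_cast; ring)
    exact (h3.sub h4).add h5
  have hmono : MonotoneOn
      (fun s : ℝ => f (a + s • d) - s * inner ℝ (gradientWithin f S a) d + C / 2 * s ^ 2 * ‖d‖ ^ 2)
      (Set.Icc 0 1) := by
    refine monotoneOn_of_hasDerivWithinAt_nonneg (convex_Icc _ _)
      (fun s hs => (hder s hs).continuousWithinAt)
      (fun s hs => (hder s (interior_subset hs)).mono interior_subset) ?_
    intro s hs
    have hs := interior_subset hs
    have h1 := hf.2 _ (hseg s hs) _ ha
    rw [add_sub_cancel_left, norm_smul, Real.norm_of_nonneg hs.1] at h1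
    have h2 := neg_le_of_abs_le
      (abs_real_inner_le_norm (gradientWithin f S (a + s • d) - gradientWithin f S a) d)
    rw [inner_sub_left] at h2
    nlinarith [norm_nonneg d, mul_le_mul_of_nonneg_right h1 (norm_nonneg d)]
  have := hmono (Set.left_mem_Icc.2 zero_le_one) (Set.right_mem_Icc.2 zero_le_one) zero_le_one
  simp only [zero_smul, add_zero, one_smul, zero_mul, sub_zero, one_mul] at this
  have hab : a + d = b := by rw [hd]; abel
  rw [hab] at this
  linarith

/-- Gradient of the penalty part of an augmented Lagrangian along an affine map. -/
theorem hasGradientAt_inner_add_sq {E Z : Type*} [NormedAddCommGroup E] [InnerProductSpace ℝ E]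
    [FiniteDimensional ℝ E] [CompleteSpace E] [NormedAddCommGroup Z] [InnerProductSpace ℝ Z]
    [FiniteDimensional ℝ Z] (L : E →ₗ[ℝ] Z) (e v : Z) (ρ : ℝ) (x : E) :
    HasGradientAt (fun x => inner ℝ v (L x + e) + ρ / 2 * ‖L x + e‖ ^ 2)
      (L.adjoint (v + ρ • (L x + e))) x := by
  have hL : HasFDerivAt (fun x => L x + e) (LinearMap.toContinuousLinearMap L) x :=
    (LinearMap.toContinuousLinearMap L).hasFDerivAt.add_const e
  have h1 := ((hasFDerivAt_const v x).inner ℝ hL).add (hL.norm_sq.const_mul (ρ / 2))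
  rw [hasGradientAt_iff_hasFDerivAt]
  refine h1.congr_fderiv ?_
  ext d
  simp [LinearMap.adjoint_inner_left]
  ring

theorem eq_zero_of_forall_inner_add_sq_nonneg {E : Type*} [NormedAddCommGroup E]
    [InnerProductSpace ℝ E] {g : E} {κ : ℝ} (hκ : 0 < κ)
    (h : ∀ d, 0 ≤ inner ℝ g d + κ * ‖d‖ ^ 2) : g = 0 := by
  -- test the inequality at the minimiser of the quadratic
  have := h (-(1 / (2 * κ)) • g)
  rw [real_inner_smul_right, real_inner_self_eq_norm_sq, norm_smul, mul_pow, Real.norm_eq_abs,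
    sq_abs] at this
  have h2 : -(1 / (2 * κ)) * ‖g‖ ^ 2 + κ * ((-(1 / (2 * κ))) ^ 2 * ‖g‖ ^ 2)
      = -(1 / (4 * κ)) * ‖g‖ ^ 2 := by field_simp; ring
  rw [h2] at this
  have h3 : 0 < 1 / (4 * κ) := by positivity
  have h4 : ‖g‖ ^ 2 = 0 := le_antisymm (by nlinarith) (by positivity)
  simpa using h4

namespace GridData

variable {Bus Gen : Type} {M : ℕ}

theorem convex_currents : Convex ℝ (currents M) := by
  intro a ha b hb s t hs ht _ i
  have := ha i
  have := hb i
  simp only [PiLp.add_apply, PiLp.smul_apply, smul_eq_mul]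
  positivity

theorem convex_Rmp (D : GridData Bus Gen M) (g : Gen) : Convex ℝ (D.Rmp g) := by
  intro a ha b hb s t hs ht hst i j hij
  have h1 := ha i j hij
  have h2 := hb i j hij
  obtain rfl : t = 1 - s := by linarith
  simp only [PiLp.add_apply, PiLp.smul_apply, smul_eq_mul]
  constructor <;> nlinarith

/-! ### The line subproblem -/

/-- At a KKT point of a line problem, the objective gradient pairs with every feasible displacement
almost nonnegatively: nonconvexity of the temperature limits costs `CΔ/2` times the sum of the
multipliers. -/
theorem IsTmpKKT.le_inner {D : GridData Bus Gen M} {model : ThermalModel} {l : D.Line} {CΔ Λ : ℝ}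
    (hC : ∀ t, IsSmoothOn CΔ (D.Phi model l t) (currents M)) {G : Fin M → ℝ}
    {c c' : EuclideanSpace ℝ (Fin M)} (h : D.IsTmpKKT model l Λ G c) (hc : c ∈ currents M)
    (hc' : c' ∈ currents M) (hT : ∀ t, D.Phi model l t c' ≤ D.Tmax) :
    -(CΔ * Λ / 2 * ‖c' - c‖ ^ 2) ≤ ∑ s, G s * (c' s - c s) := by
  obtain ⟨lam, mu, hlam, hmu, hcl, hcm, hst, hsum⟩ := h
  -- a negative `CΔ` is possible only if the space of currents is trivial
  have hCd : 0 ≤ CΔ * ‖c' - c‖ ^ 2 := by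
    rcases isEmpty_or_nonempty (Fin M) with _ | ⟨⟨t⟩⟩
    · simp [Subsingleton.elim c' c]
    · have := (norm_nonneg _).trans ((hC t).2 c' hc' c hc)
      nlinarith [norm_nonneg (c' - c), mul_nonneg this (norm_nonneg (c' - c))]
  have h1 : ∑ s, G s * (c' s - c s) = ∑ s, mu s * c' s
      - ∑ t, lam t * inner ℝ (gradientWithin (D.Phi model l t) (currents M) c) (c' - c) := by
    simp only [PiLp.inner_apply, Finset.mul_sum]
    rw [Finset.sum_comm, ← Finset.sum_sub_distrib]
    refine Finset.sum_congr rfl fun s _ => ?_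
    have h2 : G s = mu s
        - ∑ t, lam t * gradientWithin (D.Phi model l t) (currents M) c s := by
      linarith [hst s]
    rw [h2, sub_mul, Finset.sum_mul, mul_sub, hcm s, sub_zero]
    congr 1
    refine Finset.sum_congr rfl fun t _ => ?_
    simp only [PiLp.sub_apply, RCLike.inner_apply, conj_trivial]
    ring
  have h3 : 0 ≤ ∑ s, mu s * c' s := Finset.sum_nonneg fun s _ => mul_nonneg (hmu s) (hc' s)
  have h4 : ∑ t, lam t * inner ℝ (gradientWithin (D.Phi model l t) (currents M) c) (c' - c)
      ≤ ∑ t, lam t * (CΔ / 2 * ‖c' - c‖ ^ 2) := by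
    refine Finset.sum_le_sum fun t _ => ?_
    have h5 := mul_le_mul_of_nonneg_left ((hC t).sub_le convex_currents hc hc') (hlam t)
    have h6 := mul_le_mul_of_nonneg_left (hT t) (hlam t)
    have h7 := hcl t
    nlinarith
  rw [← Finset.sum_mul] at h4
  rw [h1]
  nlinarith

/-! ### Cost and currents on the feasible set of the `x`-block -/

section XBlock

variable [Fintype Bus] [Fintype Gen]

theorem differentiable_totalCost (D : GridData Bus Gen M) : Differentiable ℝ D.totalCost := by
  have hc := D.cost_differentiable
  unfold totalCost xP
  fun_prop

variable [DecidableEq Bus]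

theorem abs_xCur_le (D : GridData Bus Gen M) {x : D.XSpace} (hx : x ∈ D.XSet) (l : D.Line)
    (t : Fin M) : |D.xCur x l t| ≤ 2 * ((|D.cond l.1.1 l.1.2| + |D.susc l.1.1 l.1.2|)
      * (|D.Vmax l.1.1| + |D.Vmax l.1.2|)) ^ 2 := by
  obtain ⟨-, -, hV, -, -, -, hre, him, hcur⟩ := hx t
  have he : ∀ i, |D.xE x i t| ≤ |D.Vmax i| := fun i => sq_le_sq.1 (by
    have := (hV i).2; simp only [nu] at this; nlinarith [sq_nonneg (D.xF x i t)])
  have hf : ∀ i, |D.xF x i t| ≤ |D.Vmax i| := fun i => sq_le_sq.1 (by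
    have := (hV i).2; simp only [nu] at this; nlinarith [sq_nonneg (D.xE x i t)])
  have hed := (abs_sub (D.xE x l.1.1 t) (D.xE x l.1.2 t)).trans (add_le_add (he _) (he _))
  have hfd := (abs_sub (D.xF x l.1.1 t) (D.xF x l.1.2 t)).trans (add_le_add (hf _) (hf _))
  have h1 : |D.xIre x l t| ≤ (|D.cond l.1.1 l.1.2| + |D.susc l.1.1 l.1.2|)
      * (|D.Vmax l.1.1| + |D.Vmax l.1.2|) := by
    rw [hre l, add_mul]
    refine (abs_sub _ _).trans (add_le_add ?_ ?_) <;> rw [abs_mul] <;> gcongr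
  have h2 : |D.xIim x l t| ≤ (|D.cond l.1.1 l.1.2| + |D.susc l.1.1 l.1.2|)
      * (|D.Vmax l.1.1| + |D.Vmax l.1.2|) := by
    rw [him l, add_mul]
    refine (abs_add_le _ _).trans (add_le_add ?_ ?_) <;> rw [abs_mul] <;> gcongr
  rw [hcur l, abs_of_nonneg (by positivity), ← sq_abs (D.xIre x l t), ← sq_abs (D.xIim x l t)]
  have h3 := pow_le_pow_left₀ (abs_nonneg _) h1 2
  have h4 := pow_le_pow_left₀ (abs_nonneg _) h2 2
  linarith

theorem exists_abs_totalCost_le (D : GridData Bus Gen M) :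
    ∃ R, ∀ x ∈ D.XSet, |D.totalCost x| ≤ R := by
  have hb : ∀ g, ∃ b : ℝ, ∀ p ∈ Set.Icc (D.Pmin g) (D.Pmax g), ‖D.cost g p‖ ≤ b := fun g =>
    isCompact_Icc.exists_bound_of_continuousOn (D.cost_differentiable g).continuous.continuousOn
  choose b hb using hb
  refine ⟨∑ _t : Fin M, ∑ g, b g, fun x hx => ?_⟩
  refine (Finset.abs_sum_le_sum_abs _ _).trans (Finset.sum_le_sum fun t _ => ?_)
  refine (Finset.abs_sum_le_sum_abs _ _).trans (Finset.sum_le_sum fun g _ => ?_)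
  obtain ⟨-, -, -, -, hP, -⟩ := hx t
  exact hb g _ (hP g)

end XBlock

/-! ### The consensus matrices and gradients of the augmented Lagrangian -/

/-- Position of a consensus coordinate in the `x`-block. -/
def toXIdx (D : GridData Bus Gen M) (c : D.CIdx) : D.XIdx :=
  (Sum.elim (fun g => .inl g) (fun l => .inr (.inl l)) c.1, c.2)

/-- Position of a consensus coordinate in the `y`-block. -/
def toYIdx (D : GridData Bus Gen M) (c : D.CIdx) : D.YIdx :=
  (Sum.elim (fun g => .inl g) (fun l => .inr (.inl l)) c.1, c.2)

theorem toYIdx_injective (D : GridData Bus Gen M) : Function.Injective D.toYIdx := by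
  rintro ⟨g | l, t⟩ ⟨g' | l', t'⟩ h <;> simp_all [toYIdx]

section BMatrix

variable [DecidableEq Bus] [Fintype Gen] [DecidableEq Gen]

theorem B_apply (D : GridData Bus Gen M) (y : D.YSpace) (c : D.CIdx) :
    Matrix.toEuclideanLin D.B y c = y (D.toYIdx c) := by
  simp [Matrix.toLpLin_apply, Matrix.mulVec, dotProduct, B, toYIdx]

theorem B_transpose_apply (D : GridData Bus Gen M) (q : D.CSpace) (c : D.CIdx) :
    Matrix.toEuclideanLin D.B.transpose q (D.toYIdx c) = q c := by
  have h : ∀ c', D.B c' (D.toYIdx c) = if c' = c then 1 else 0 := by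
    intro c'
    have : D.B c' (D.toYIdx c) = if D.toYIdx c = D.toYIdx c' then 1 else 0 := rfl
    simp only [this, D.toYIdx_injective.eq_iff, eq_comm]
  simp [Matrix.toLpLin_apply, Matrix.mulVec, dotProduct, h]

theorem B_transpose (D : GridData Bus Gen M) :
    Matrix.toEuclideanLin D.B.transpose = (Matrix.toEuclideanLin D.B).adjoint := by
  rw [← Matrix.toEuclideanLin_conjTranspose_eq_adjoint,
    Matrix.conjTranspose_eq_transpose_of_trivial]

end BMatrix

variable [Fintype Bus] [DecidableEq Bus] [Fintype Gen] [DecidableEq Gen]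

theorem A_apply (D : GridData Bus Gen M) (x : D.XSpace) (c : D.CIdx) :
    Matrix.toEuclideanLin D.A x c = -x (D.toXIdx c) := by
  simp [Matrix.toLpLin_apply, Matrix.mulVec, dotProduct, A, toXIdx]

theorem A_transpose (D : GridData Bus Gen M) :
    Matrix.toEuclideanLin D.A.transpose = (Matrix.toEuclideanLin D.A).adjoint := by
  rw [← Matrix.toEuclideanLin_conjTranspose_eq_adjoint,
    Matrix.conjTranspose_eq_transpose_of_trivial]

theorem exists_norm_A_le (D : GridData Bus Gen M) :
    ∃ R, ∀ x ∈ D.XSet, ‖Matrix.toEuclideanLin D.A x‖ ≤ R := by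
  have hb : ∀ c : D.CIdx, ∃ b : ℝ, ∀ x ∈ D.XSet, ‖Matrix.toEuclideanLin D.A x c‖ ≤ b := by
    rintro ⟨g | l, t⟩
    · refine ⟨max |D.Pmin g| |D.Pmax g|, fun x hx => ?_⟩
      obtain ⟨-, -, -, -, hP, -⟩ := hx t
      rw [A_apply, norm_neg]
      exact abs_le_max_abs_abs (hP g).1 (hP g).2
    · refine ⟨2 * ((|D.cond l.1.1 l.1.2| + |D.susc l.1.1 l.1.2|)
        * (|D.Vmax l.1.1| + |D.Vmax l.1.2|)) ^ 2, fun x hx => ?_⟩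
      rw [A_apply, norm_neg]
      exact D.abs_xCur_le hx l t
  choose b hb using hb
  refine ⟨Real.sqrt (∑ c, b c ^ 2), fun x hx => ?_⟩
  rw [EuclideanSpace.norm_eq]
  refine Real.sqrt_le_sqrt (Finset.sum_le_sum fun c _ => ?_)
  exact pow_le_pow_left₀ (norm_nonneg _) (hb c x hx) 2

theorem gradient_augLag_x (D : GridData Bus Gen M) (θ ρ : ℝ) (w : D.CSpace) (x : D.XSpace)
    (y : D.YSpace) (u v : D.CSpace) :
    gradient (fun x' => D.augLag θ ρ w x' y u v) x = gradient D.totalCost x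
      + Matrix.toEuclideanLin D.A.transpose (v + ρ • D.resid x y u) := by
  have h1 := (hasGradientAt_inner_add_sq (Matrix.toEuclideanLin D.A)
    (Matrix.toEuclideanLin D.B y + u) v ρ x).hasFDerivAt
  have h2 := (D.differentiable_totalCost x).hasGradientAt.hasFDerivAt
  have h3 := (h2.add h1).add_const (inner ℝ w u + θ / 2 * ‖u‖ ^ 2)
  apply HasGradientAt.gradient
  rw [hasGradientAt_iff_hasFDerivAt, map_add, A_transpose]
  refine HasFDerivAt.congr_of_eventuallyEq (by simpa [resid, add_assoc] using h3) ?_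
  refine Filter.Eventually.of_forall fun x' => ?_
  simp only [augLag, resid, add_assoc]
  ring

theorem gradient_augLag_y (D : GridData Bus Gen M) (θ ρ : ℝ) (w : D.CSpace) (x : D.XSpace)
    (y : D.YSpace) (u v : D.CSpace) :
    gradient (fun y' => D.augLag θ ρ w x y' u v) y
      = Matrix.toEuclideanLin D.B.transpose (v + ρ • D.resid x y u) := by
  have h1 := (hasGradientAt_inner_add_sq (Matrix.toEuclideanLin D.B)
    (Matrix.toEuclideanLin D.A x + u) v ρ y).hasFDerivAt
  have h3 := h1.add_const (D.totalCost x + inner ℝ w u + θ / 2 * ‖u‖ ^ 2)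
  have hr : ∀ y', Matrix.toEuclideanLin D.B y' + (Matrix.toEuclideanLin D.A x + u)
      = D.resid x y' u := fun y' => by unfold resid; abel
  simp only [hr] at h3
  apply HasGradientAt.gradient
  rw [hasGradientAt_iff_hasFDerivAt, B_transpose]
  refine HasFDerivAt.congr_of_eventuallyEq h3 ?_
  refine Filter.Eventually.of_forall fun y' => ?_
  simp only [augLag]
  ring

theorem augLag_y_expansion (D : GridData Bus Gen M) (θ ρ : ℝ) (w : D.CSpace) (x : D.XSpace)
    (y z : D.YSpace) (u v : D.CSpace) :
    D.augLag θ ρ w x z u v = D.augLag θ ρ w x y u v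
      + inner ℝ (v + ρ • D.resid x y u) (Matrix.toEuclideanLin D.B (z - y))
      + ρ / 2 * ‖Matrix.toEuclideanLin D.B (z - y)‖ ^ 2 := by
  have hr : D.resid x z u = D.resid x y u + Matrix.toEuclideanLin D.B (z - y) := by
    simp only [resid, map_sub]; abel
  simp only [augLag, hr, norm_add_sq_real, inner_add_right, inner_add_left, real_inner_smul_left]
  ring

theorem augLag_u_expansion (D : GridData Bus Gen M) (θ ρ : ℝ) (w : D.CSpace) (x : D.XSpace)
    (y : D.YSpace) (u v d : D.CSpace) :
    D.augLag θ ρ w x y (u + d) v = D.augLag θ ρ w x y u v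
      + inner ℝ (w + θ • u + (v + ρ • D.resid x y u)) d + (θ + ρ) / 2 * ‖d‖ ^ 2 := by
  have hr : D.resid x y (u + d) = D.resid x y u + d := by simp only [resid]; abel
  simp only [augLag, hr, norm_add_sq_real, inner_add_right, inner_add_left, real_inner_smul_left]
  ring

theorem augLag_v_expansion (D : GridData Bus Gen M) (θ ρ : ℝ) (w : D.CSpace) (x : D.XSpace)
    (y : D.YSpace) (u v v' : D.CSpace) :
    D.augLag θ ρ w x y u v' = D.augLag θ ρ w x y u v + inner ℝ (v' - v) (D.resid x y u) := by
  simp only [augLag, inner_sub_left]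
  ring

/-! ### Descent along the iterations -/

/-- The variational inequality of the `y`-subproblem: the slack `(ρ/4)‖B(z - y)‖²` pays for the
nonconvexity of the temperature limits, since `2 CΔ Λ ≤ ρ`. -/
theorem IsYStationary.le_inner {D : GridData Bus Gen M} {model : ThermalModel} {θ ρ : ℝ}
    {w : D.CSpace} {CΔ Λ : ℝ}
    (hC : ∀ l t, IsSmoothOn CΔ (D.Phi model l t) (currents M)) (hΛ : 2 * CΔ * Λ ≤ ρ)
    (hρ : 0 ≤ ρ) {x : D.XSpace} {y z : D.YSpace} {u v : D.CSpace}
    (h : D.IsYStationary model θ ρ w Λ x y u v) (hy : y ∈ D.YSet model)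
    (hz : z ∈ D.YSet model) :
    -(ρ / 4 * ‖Matrix.toEuclideanLin D.B (z - y)‖ ^ 2)
      ≤ inner ℝ (v + ρ • D.resid x y u) (Matrix.toEuclideanLin D.B (z - y)) := by
  obtain ⟨hl, hg⟩ := h
  rw [gradient_augLag_y] at hl hg
  set q := v + ρ • D.resid x y u with hq
  have hline : ∀ l, -(ρ / 4 * ∑ t, (D.yCur z l t - D.yCur y l t) ^ 2)
      ≤ ∑ t, q (.inr l, t) * (D.yCur z l t - D.yCur y l t) := by
    intro l
    have h1 := (hl l).le_inner (hC l) (hy.1 l).1 (hz.1 l).1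
      (fun t => by rw [← ((hz.1 l).2 t).1]; exact ((hz.1 l).2 t).2)
    have h2 : ∀ t, D.yCur (Matrix.toEuclideanLin D.B.transpose q) l t = q (.inr l, t) :=
      fun t => D.B_transpose_apply q (.inr l, t)
    simp only [h2] at h1
    rw [EuclideanSpace.real_norm_sq_eq] at h1
    simp only [PiLp.sub_apply] at h1
    refine le_trans (neg_le_neg ?_) h1
    have : 0 ≤ ∑ t, (D.yCur z l t - D.yCur y l t) ^ 2 :=
      Finset.sum_nonneg fun _ _ => sq_nonneg _
    nlinarith
  have hgen : ∀ g, 0 ≤ ∑ t, q (.inl g, t) * (D.yP z g t - D.yP y g t) := by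
    intro g
    have h1 := inner_le_zero_of_mem_normalCone (D.convex_Rmp g) (hg g) (hz.2 g)
    have h2 : ∀ t, D.yP (Matrix.toEuclideanLin D.B.transpose q) g t = q (.inl g, t) :=
      fun t => D.B_transpose_apply q (.inl g, t)
    rw [inner_neg_left, neg_nonpos, PiLp.inner_apply] at h1
    simpa [h2, mul_comm] using h1
  have hgen' : ∀ g, 0 ≤ ρ / 4 * ∑ t, (D.yP z g t - D.yP y g t) ^ 2 := fun g =>
    mul_nonneg (by positivity) (Finset.sum_nonneg fun _ _ => sq_nonneg _)
  rw [EuclideanSpace.real_norm_sq_eq, PiLp.inner_apply]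
  simp only [B_apply, Fintype.sum_prod_type, Fintype.sum_sum_type, PiLp.sub_apply,
    RCLike.inner_apply, conj_trivial]
  rw [mul_add, neg_add, Finset.mul_sum, Finset.mul_sum, ← Finset.sum_neg_distrib,
    ← Finset.sum_neg_distrib]
  refine add_le_add (Finset.sum_le_sum fun g _ => ?_) (Finset.sum_le_sum fun l _ => ?_)
  · refine le_trans (neg_nonpos.2 (hgen' g)) ((hgen g).trans_eq ?_)
    exact Finset.sum_congr rfl fun t _ => mul_comm _ _
  · exact (hline l).trans_eq (Finset.sum_congr rfl fun t _ => mul_comm _ _)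

/-- The exact `u`-minimisation and the multiplier update make `v` an affine function of `u`. -/
theorem IsAdmmStep.add_smul_add_eq_zero {D : GridData Bus Gen M} {model : ThermalModel} {θ ρ : ℝ}
    (hθ : 0 < θ) (hρ : 0 < ρ) {w : D.CSpace} {Λ : ℝ} {y : D.YSpace} {u v : D.CSpace}
    {x' : D.XSpace} {y' : D.YSpace} {u' v' : D.CSpace}
    (h : D.IsAdmmStep model θ ρ w Λ y u v x' y' u' v') : w + θ • u' + v' = 0 := by
  rw [h.v_update]
  refine eq_zero_of_forall_inner_add_sq_nonneg (κ := (θ + ρ) / 2) (by positivity) fun d => ?_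
  have := h.u_min (u' + d)
  rw [augLag_u_expansion] at this
  linarith

/-- One iteration decreases the augmented Lagrangian, once `v` and `u` are tied by the optimality
condition of the previous `u`-step. The multiplier update raises it by `(θ/2)‖u' - u‖²`, less than
the gain `(3θ/2)‖u' - u‖²` of the `u`-step. -/
theorem IsAdmmStep.augLag_le {D : GridData Bus Gen M} {model : ThermalModel} {θ ρ : ℝ}
    (hθ : 0 < θ) (hρ : ρ = 2 * θ) {w : D.CSpace} {CΔ Λ : ℝ}
    (hC : ∀ l t, IsSmoothOn CΔ (D.Phi model l t) (currents M)) (hΛ : 2 * CΔ * Λ ≤ ρ)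
    {x : D.XSpace} {y : D.YSpace} {u v : D.CSpace}
    {x' : D.XSpace} {y' : D.YSpace} {u' v' : D.CSpace}
    (h : D.IsAdmmStep model θ ρ w Λ y u v x' y' u' v') (hy : y ∈ D.YSet model)
    (hv : w + θ • u + v = 0) (hx : D.augLag θ ρ w x' y u v ≤ D.augLag θ ρ w x y u v) :
    D.augLag θ ρ w x' y' u' v' + (θ / 2 * ‖Matrix.toEuclideanLin D.B (y - y')‖ ^ 2
      + θ * ‖u' - u‖ ^ 2) ≤ D.augLag θ ρ w x y u v := by
  have hρ0 : 0 < ρ := by linarith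
  have hv' := h.add_smul_add_eq_zero hθ hρ0
  have h1 := h.y_stationary.le_inner hC hΛ hρ0.le h.y_mem hy
  have h2 := D.augLag_y_expansion θ ρ w x' y' y u v
  have h3 := D.augLag_u_expansion θ ρ w x' y' u' v (u - u')
  rw [← h.v_update, hv', inner_zero_left, add_sub_cancel, norm_sub_rev] at h3
  have h4 := D.augLag_v_expansion θ ρ w x' y' u' v v'
  have h5 : v' - v = -(θ • (u' - u)) := by
    have e1 : v' = -(w + θ • u') := eq_neg_of_add_eq_zero_right hv'
    have e2 : v = -(w + θ • u) := eq_neg_of_add_eq_zero_right hv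
    rw [e1, e2, smul_sub]; abel
  have h6 : ρ * inner ℝ (v' - v) (D.resid x' y' u') = θ ^ 2 * ‖u' - u‖ ^ 2 := by
    have : ρ • D.resid x' y' u' = v' - v := by rw [h.v_update]; abel
    rw [← real_inner_smul_right, this, real_inner_self_eq_norm_sq, h5, norm_neg, norm_smul,
      Real.norm_of_nonneg hθ.le, mul_pow]
  have h7 : inner ℝ (v' - v) (D.resid x' y' u') = θ / 2 * ‖u' - u‖ ^ 2 := by
    have : 2 * θ * inner ℝ (v' - v) (D.resid x' y' u') = 2 * θ * (θ / 2 * ‖u' - u‖ ^ 2) := by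
      rw [← hρ, h6, hρ]; ring
    exact mul_left_cancel₀ (by positivity) this
  subst hρ
  nlinarith

/-- With `v = -(w + θ u)` and residual `p`, the augmented Lagrangian is
`C(x) + ⟪w, u - p⟫ + (θ/2)‖u - p‖² + (θ/2)‖p‖²`, which bounds it below. -/
theorem le_augLag {D : GridData Bus Gen M} {θ ρ : ℝ} (hθ : 0 < θ) (hρ : ρ = 2 * θ) {w : D.CSpace}
    (x : D.XSpace) (y : D.YSpace) {u v : D.CSpace} (hv : w + θ • u + v = 0) :
    D.totalCost x - ‖w‖ ^ 2 / (2 * θ) ≤ D.augLag θ ρ w x y u v := by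
  set p := D.resid x y u with hp
  have e2 : v = -(w + θ • u) := eq_neg_of_add_eq_zero_right hv
  have h1 : D.augLag θ ρ w x y u v = D.totalCost x + inner ℝ w (u - p) + θ / 2 * ‖u - p‖ ^ 2
      + θ / 2 * ‖p‖ ^ 2 := by
    simp only [augLag, ← hp, e2, hρ, inner_neg_left, inner_add_left, inner_sub_right,
      real_inner_smul_left, norm_sub_sq_real]
    ring
  have h2 := neg_le_of_abs_le (abs_real_inner_le_norm w (u - p))
  have h3 : 0 ≤ θ / 2 * (‖u - p‖ - ‖w‖ / θ) ^ 2 := by positivity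
  have h4 : θ / 2 * (‖u - p‖ - ‖w‖ / θ) ^ 2
      = θ / 2 * ‖u - p‖ ^ 2 - ‖w‖ * ‖u - p‖ + ‖w‖ ^ 2 / (2 * θ) := by field_simp; ring
  have h5 : 0 ≤ θ / 2 * ‖p‖ ^ 2 := by positivity
  rw [h1]
  linarith

/-- The augmented Lagrangian after the first iteration is bounded in terms of the data and the
initial `u` and `v`, even when the initial `y` is infeasible: comparison with a fixed feasible `z`
bounds `B y'`, and `u'` and `v'` are continuous functions of `A x' + B y'`. -/
theorem exists_augLag_le_of_isAdmmStep (D : GridData Bus Gen M) (model : ThermalModel) {θ ρ : ℝ}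
    (hθ : 0 < θ) (hρ : 0 < ρ) (w : D.CSpace) {CΔ Λ : ℝ}
    (hC : ∀ l t, IsSmoothOn CΔ (D.Phi model l t) (currents M)) (hΛ : 2 * CΔ * Λ ≤ ρ)
    (u v : D.CSpace) :
    ∃ R, ∀ y x' y' u' v', D.IsAdmmStep model θ ρ w Λ y u v x' y' u' v' →
      D.augLag θ ρ w x' y' u' v' ≤ R := by
  rcases (D.YSet model).eq_empty_or_nonempty with hY | ⟨z, hz⟩
  · exact ⟨0, fun y x' y' u' v' h => absurd h.y_mem (by simp [hY])⟩
  obtain ⟨R₁, hR₁⟩ := D.exists_norm_A_le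
  obtain ⟨R₂, hR₂⟩ := D.exists_abs_totalCost_le
  set S : ℝ := ‖v‖ + ρ * (R₁ + ‖Matrix.toEuclideanLin D.B z‖ + ‖u‖) with hS
  -- the value of `u'` in terms of `a = A x' + B y'`
  let U : D.CSpace → D.CSpace := fun a => -((θ + ρ)⁻¹ • (w + v + ρ • a))
  let F : D.CSpace → ℝ := fun a => inner ℝ w (U a) + θ / 2 * ‖U a‖ ^ 2
    + inner ℝ (v + ρ • (a + U a)) (a + U a) + ρ / 2 * ‖a + U a‖ ^ 2
  have hF : Continuous F := by fun_prop
  obtain ⟨R₃, hR₃⟩ := (isCompact_closedBall (0 : D.CSpace)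
    (R₁ + ‖Matrix.toEuclideanLin D.B z‖ + 2 * S / ρ)).exists_bound_of_continuousOn
      hF.continuousOn
  refine ⟨R₂ + R₃, fun y x' y' u' v' h => ?_⟩
  have hA := hR₁ x' h.x_mem
  have hd : ‖Matrix.toEuclideanLin D.B (z - y')‖ ≤ 2 * S / ρ := by
    have h1 := h.y_stationary.le_inner hC hΛ hρ.le h.y_mem hz
    set d := Matrix.toEuclideanLin D.B (z - y') with hd
    have h2 : v + ρ • D.resid x' y' u = v + ρ • D.resid x' z u - ρ • d := by
      simp only [resid, hd, map_sub, smul_add, smul_sub]; abel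
    rw [h2, inner_sub_left, real_inner_smul_left, real_inner_self_eq_norm_sq] at h1
    have h3 := (real_inner_le_norm (v + ρ • D.resid x' z u) d)
    have h4 : ‖v + ρ • D.resid x' z u‖ ≤ S := by
      refine (norm_add_le _ _).trans ?_
      rw [norm_smul, Real.norm_of_nonneg hρ.le, hS]
      gcongr
      exact (norm_add_le _ _).trans (by gcongr; exact (norm_add_le _ _).trans (by gcongr))
    have h5 := mul_le_mul_of_nonneg_right h4 (norm_nonneg d)
    rw [le_div_iff₀ hρ]
    have hS0 : 0 ≤ S := (norm_nonneg _).trans h4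
    by_contra! hc
    have hd0 : 0 < ‖d‖ := by
      rcases (norm_nonneg d).lt_or_eq with h | h
      · exact h
      · rw [← h] at hc; linarith
    nlinarith
  set a := Matrix.toEuclideanLin D.A x' + Matrix.toEuclideanLin D.B y' with ha
  have han : ‖a‖ ≤ R₁ + ‖Matrix.toEuclideanLin D.B z‖ + 2 * S / ρ := by
    have h1 : a = Matrix.toEuclideanLin D.A x' + Matrix.toEuclideanLin D.B z
        - Matrix.toEuclideanLin D.B (z - y') := by rw [ha, map_sub]; abel
    rw [h1]
    exact (norm_sub_le _ _).trans (add_le_add ((norm_add_le _ _).trans (by gcongr)) hd)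
  have hv' := h.add_smul_add_eq_zero hθ hρ
  have hres : D.resid x' y' u' = a + u' := rfl
  clear_value a
  have hu : u' = U a := by
    have h1 : (θ + ρ) • u' = -(w + v + ρ • a) := by
      rw [h.v_update, hres] at hv'
      rw [eq_neg_iff_add_eq_zero, ← hv', add_smul, smul_add]; abel
    have h2 : θ + ρ ≠ 0 := by positivity
    simp only [U]
    rw [← smul_neg, ← h1, inv_smul_smul₀ h2]
  have h1 := hR₃ a (by simpa using han)
  have h2 := hR₂ x' h.x_mem
  have h3 : D.augLag θ ρ w x' y' u' v' = D.totalCost x' + F a := by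
    rw [augLag, h.v_update, hres, hu]
    ring
  rw [h3]
  exact add_le_add ((le_abs_self _).trans h2) ((le_abs_self _).trans h1)

/-! ### Stationarity from small steps -/

/-- If `u` and `B y` move by at most `δ` in an iteration, the new iterate is stationary up to a
constant times `δ`. The witness is the new multiplier `v'`; it differs from the multipliers
`v + ρ p` of the two subproblems only through these displacements. -/
theorem IsAdmmStep.isEpsStationary {D : GridData Bus Gen M} {model : ThermalModel} {θ ρ : ℝ}
    (hθ : 0 < θ) (hρ : ρ = 2 * θ) {w : D.CSpace} {CΔ Λ : ℝ}
    (hC : ∀ l t, IsSmoothOn CΔ (D.Phi model l t) (currents M)) (hΛ : 2 * CΔ * Λ ≤ ρ)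
    {y : D.YSpace} {u v : D.CSpace} {x' : D.XSpace} {y' : D.YSpace} {u' v' : D.CSpace}
    (h : D.IsAdmmStep model θ ρ w Λ y u v x' y' u' v') (hv : w + θ • u + v = 0) {κ ε δ : ℝ}
    (hA : ∀ q, ‖Matrix.toEuclideanLin D.A.transpose q‖ ≤ κ * ‖q‖)
    (hB : ∀ q, ‖Matrix.toEuclideanLin D.B.transpose q‖ ≤ κ * ‖q‖) (hκ : 0 ≤ κ)
    (hδ : (2 * ρ * κ + 1) * δ ≤ ε) (hyδ : ‖Matrix.toEuclideanLin D.B (y - y')‖ ≤ δ)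
    (huδ : ‖u' - u‖ ≤ δ) : D.IsEpsStationary model θ w ε x' y' u' := by
  have hρ0 : 0 < ρ := by linarith
  have hδ0 : 0 ≤ δ := (norm_nonneg _).trans huδ
  have hv' := h.add_smul_add_eq_zero hθ hρ0
  have hκδ : 0 ≤ ρ * (κ * δ) := by positivity
  refine ⟨h.x_mem, h.y_mem, v', ⟨_, h.x_stationary, ?_⟩,
    ⟨-Matrix.toEuclideanLin D.B.transpose (v + ρ • D.resid x' y' u), ?_, ?_⟩, hv', ?_⟩
  · have h1 : gradient D.totalCost x' + Matrix.toEuclideanLin D.A.transpose v'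
        + -gradient (fun x => D.augLag θ ρ w x y u v) x'
        = ρ • Matrix.toEuclideanLin D.A.transpose
          ((u' - u) - Matrix.toEuclideanLin D.B (y - y')) := by
      rw [gradient_augLag_x, h.v_update, ← map_smul]
      have h2 : ρ • ((u' - u) - Matrix.toEuclideanLin D.B (y - y'))
          = (v + ρ • D.resid x' y' u') - (v + ρ • D.resid x' y u) := by
        simp only [resid, map_sub, smul_add, smul_sub]; abel
      rw [h2, map_sub]; abel
    rw [h1, norm_smul, Real.norm_of_nonneg hρ0.le]
    have h3 : ‖(u' - u) - Matrix.toEuclideanLin D.B (y - y')‖ ≤ δ + δ :=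
      (norm_sub_le _ _).trans (add_le_add huδ hyδ)
    have h4 := mul_le_mul_of_nonneg_left
      ((hA _).trans (mul_le_mul_of_nonneg_left h3 hκ)) hρ0.le
    linarith
  · apply regularNormalCone_subset_normalCone
    set LB := LinearMap.toContinuousLinearMap (Matrix.toEuclideanLin D.B) with hLB
    refine mem_regularNormalCone_of_quadratic_bound h.y_mem (κ := ρ / 4 * ‖LB‖ ^ 2)
      (by positivity) fun z hz => ?_
    have h1 := h.y_stationary.le_inner hC hΛ hρ0.le h.y_mem hz
    have h2 : ‖Matrix.toEuclideanLin D.B (z - y')‖ ≤ ‖LB‖ * ‖z - y'‖ := LB.le_opNorm _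
    have h3 := pow_le_pow_left₀ (norm_nonneg _) h2 2
    rw [inner_neg_left, B_transpose, LinearMap.adjoint_inner_left]
    rw [mul_pow] at h3
    nlinarith
  · rw [← sub_eq_add_neg, ← map_sub]
    have h1 : v' - (v + ρ • D.resid x' y' u) = ρ • (u' - u) := by
      rw [h.v_update]; simp only [resid, smul_add, smul_sub]; abel
    rw [h1, map_smul, norm_smul, Real.norm_of_nonneg hρ0.le]
    have h4 := mul_le_mul_of_nonneg_left
      ((hB (u' - u)).trans (mul_le_mul_of_nonneg_left huδ hκ)) hρ0.le
    linarith
  · have h1 : ρ • D.resid x' y' u' = -(θ • (u' - u)) := by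
      have e1 : v' = -(w + θ • u') := eq_neg_of_add_eq_zero_right hv'
      have e2 : v = -(w + θ • u) := eq_neg_of_add_eq_zero_right hv
      have e3 : ρ • D.resid x' y' u' = v' - v := by rw [h.v_update]; abel
      rw [e3, e1, e2, smul_sub]; abel
    have h2 := congrArg norm h1
    rw [norm_neg, norm_smul, norm_smul, Real.norm_of_nonneg hρ0.le, Real.norm_of_nonneg hθ.le,
      hρ] at h2
    have h3 : 2 * ‖D.resid x' y' u'‖ = ‖u' - u‖ := by
      apply mul_left_cancel₀ hθ.ne'; linarith
    nlinarith [norm_nonneg (D.resid x' y' u')]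

theorem exists_norm_transpose_le (D : GridData Bus Gen M) :
    ∃ κ, 0 ≤ κ ∧ (∀ q, ‖Matrix.toEuclideanLin D.A.transpose q‖ ≤ κ * ‖q‖) ∧
      ∀ q, ‖Matrix.toEuclideanLin D.B.transpose q‖ ≤ κ * ‖q‖ := by
  set LA := LinearMap.toContinuousLinearMap (Matrix.toEuclideanLin D.A.transpose)
  set LB := LinearMap.toContinuousLinearMap (Matrix.toEuclideanLin D.B.transpose)
  exact ⟨max ‖LA‖ ‖LB‖, (norm_nonneg _).trans (le_max_left _ _),
    fun q => (LA.le_opNorm q).trans (by gcongr; exact le_max_left _ _),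
    fun q => (LB.le_opNorm q).trans (by gcongr; exact le_max_right _ _)⟩

end GridData

/-- A sequence that stays in an interval of length `R` and whose decreases dominate `s` has a small
`s` among any `n` steps. -/
theorem exists_le_of_add_le_of_le {a s : ℕ → ℝ} {n : ℕ} {R η : ℝ} (hn : 0 < n) (hR : R ≤ n * η)
    (hstep : ∀ r < n, a (r + 1) + s r ≤ a r) (hgap : a 0 - a n ≤ R) : ∃ r < n, s r ≤ η := by
  by_contra! hc
  have h1 : ∑ r ∈ Finset.range n, s r ≤ a 0 - a n := by
    rw [← Finset.sum_range_sub']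
    exact Finset.sum_le_sum fun r hr => by linarith [hstep r (Finset.mem_range.1 hr)]
  have h2 : ∑ _r ∈ Finset.range n, η < ∑ r ∈ Finset.range n, s r :=
    Finset.sum_lt_sum_of_nonempty (Finset.nonempty_range_iff.2 hn.ne')
      fun r hr => hc r (Finset.mem_range.1 hr)
  rw [Finset.sum_const, Finset.card_range, nsmul_eq_mul] at h2
  linarith

/-! ### The iteration bound -/

theorem mainTheorem6 {Bus Gen : Type} [Fintype Bus] [DecidableEq Bus] [Fintype Gen]
    [DecidableEq Gen] {M : ℕ} (D : GridData Bus Gen M) (model : ThermalModel)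
    (θ ρ : ℝ) (hθ : 0 < θ) (hρ : ρ = 2 * θ) (w : D.CSpace)
    (CΔ Λ : ℝ) (hC : ∀ l t, IsSmoothOn CΔ (D.Phi model l t) (GridData.currents M))
    (hΛ : 2 * CΔ * Λ ≤ ρ)
    (x₀ : D.XSpace) (y₀ : D.YSpace) (u₀ v₀ : D.CSpace) :
    ∃ K : ℝ, ∀ ε : ℝ, 0 < ε → ε ≤ 1 → ∀ N : ℕ, K / ε ^ 2 ≤ N →
      ∀ (x : ℕ → D.XSpace) (y : ℕ → D.YSpace) (u v : ℕ → D.CSpace),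
        x 0 = x₀ → y 0 = y₀ → u 0 = u₀ → v 0 = v₀ →
        (∀ r < N, D.IsAdmmStep model θ ρ w Λ (y r) (u r) (v r)
          (x (r + 1)) (y (r + 1)) (u (r + 1)) (v (r + 1))) →
        (∀ r < N, D.augLag θ ρ w (x (r + 1)) (y r) (u r) (v r)
          ≤ D.augLag θ ρ w (x r) (y r) (u r) (v r)) →
        ∃ r : ℕ, 1 ≤ r ∧ (r : ℝ) ≤ K / ε ^ 2 ∧
          D.IsEpsStationary model θ w ε (x r) (y r) (u r) := by
  have hρ0 : 0 < ρ := by linarith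
  obtain ⟨R₁, hR₁⟩ := D.exists_augLag_le_of_isAdmmStep model hθ hρ0 w hC hΛ u₀ v₀
  obtain ⟨R₂, hR₂⟩ := D.exists_abs_totalCost_le
  obtain ⟨κ, hκ, hA, hB⟩ := D.exists_norm_transpose_le
  set c : ℝ := 2 * ρ * κ + 1 with hc
  have hc0 : 0 < c := by positivity
  -- the largest possible total decrease of the augmented Lagrangian after the first iteration
  set R : ℝ := max 0 (R₁ + R₂ + ‖w‖ ^ 2 / (2 * θ)) with hR
  have hR0 : 0 ≤ R := le_max_left _ _
  -- the summand `2` leaves room for the first iteration and for rounding `K / ε ^ 2` down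
  refine ⟨2 * c ^ 2 * R / θ + 2, fun ε hε hε1 N hN x y u v _ _ hu hv hstep hdesc => ?_⟩
  set Q : ℝ := (2 * c ^ 2 * R / θ + 2) / ε ^ 2 with hQ
  have hε2 : ε ^ 2 ≤ 1 := pow_le_one₀ hε.le hε1
  have hQ1 : 2 * c ^ 2 * R / θ / ε ^ 2 + 2 ≤ Q := by
    rw [hQ, add_div]
    gcongr
    rw [le_div_iff₀ (by positivity)]
    linarith
  have hQ0 : 2 ≤ Q := le_trans (by simp; positivity) hQ1
  obtain ⟨n, hn⟩ : ∃ n : ℕ, ⌊Q⌋₊ = n + 1 :=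
    Nat.exists_eq_succ_of_ne_zero (Nat.floor_pos.2 (by linarith)).ne'
  have hnQ : ((n + 1 : ℕ) : ℝ) ≤ Q := hn ▸ Nat.floor_le (by linarith)
  have hQn : Q < (n : ℝ) + 2 := by
    have := Nat.lt_floor_add_one Q
    rw [hn] at this; push_cast at this; linarith
  have hnN : n + 1 ≤ N := by exact_mod_cast hnQ.trans hN
  have hn0 : 0 < n := by
    have : (0 : ℝ) < n := by linarith
    exact_mod_cast this
  have hopt : ∀ r < N, w + θ • u (r + 1) + v (r + 1) = 0 := fun r hr =>
    (hstep r hr).add_smul_add_eq_zero hθ hρ0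
  obtain ⟨r, hr, hsmall⟩ := exists_le_of_add_le_of_le
    (a := fun r => D.augLag θ ρ w (x (r + 1)) (y (r + 1)) (u (r + 1)) (v (r + 1)))
    (s := fun r => θ / 2 * ‖Matrix.toEuclideanLin D.B (y (r + 1) - y (r + 1 + 1))‖ ^ 2
      + θ * ‖u (r + 1 + 1) - u (r + 1)‖ ^ 2) (n := n) (R := R) (η := θ / 2 * (ε / c) ^ 2) hn0
    (by
      have h1 : 2 * c ^ 2 * R / θ / ε ^ 2 ≤ n := by linarith
      rw [div_div, div_le_iff₀ (by positivity)] at h1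
      have h2 : (n : ℝ) * (θ / 2 * (ε / c) ^ 2) = n * (θ * ε ^ 2) / (2 * c ^ 2) := by
        field_simp
      rw [h2, le_div_iff₀ (by positivity)]
      linarith)
    (fun r hr => (hstep (r + 1) (by omega)).augLag_le hθ hρ hC hΛ (hstep r (by omega)).y_mem
      (hopt r (by omega)) (hdesc (r + 1) (by omega)))
    (by
      have h1 := hR₁ _ _ _ _ _ (hu ▸ hv ▸ hstep 0 (by omega))
      have h2 := GridData.le_augLag hθ hρ (x (n + 1)) (y (n + 1)) (hopt n (by omega))
      have h3 := neg_le_of_abs_le (hR₂ _ (hstep n (by omega)).x_mem)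
      have h4 : R₁ + R₂ + ‖w‖ ^ 2 / (2 * θ) ≤ R := le_max_right _ _
      simp only [zero_add] at h1 ⊢
      linarith)
  have hεc : 0 ≤ ε / c := by positivity
  have hy : ‖Matrix.toEuclideanLin D.B (y (r + 1) - y (r + 1 + 1))‖ ≤ ε / c := by
    refine (sq_le_sq₀ (norm_nonneg _) hεc).1 ?_
    have : 0 ≤ θ * ‖u (r + 1 + 1) - u (r + 1)‖ ^ 2 := by positivity
    exact le_of_mul_le_mul_left (by linarith) (half_pos hθ)
  have hu' : ‖u (r + 1 + 1) - u (r + 1)‖ ≤ ε / c := by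
    refine (sq_le_sq₀ (norm_nonneg _) hεc).1 ?_
    have : 0 ≤ θ / 2 * ‖Matrix.toEuclideanLin D.B (y (r + 1) - y (r + 1 + 1))‖ ^ 2 := by
      positivity
    have h2 : 0 ≤ θ / 2 * ‖u (r + 1 + 1) - u (r + 1)‖ ^ 2 := by positivity
    exact le_of_mul_le_mul_left (by linarith) (half_pos hθ)
  refine ⟨r + 1 + 1, by omega, le_trans (by exact_mod_cast Nat.succ_le_succ hr) hnQ, ?_⟩
  exact (hstep (r + 1) (by omega)).isEpsStationary hθ hρ hC hΛ (hopt r (by omega)) hA hB hκ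
    (by rw [← hc, mul_div_cancel₀ _ hc0.ne']) hy hu'
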